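/- Let $n=2k$ with $k\ge 1$ and let $\mathbb H^n=\{x\in\mathbb R^{1,n}:\ -x_0^2+x_1^2+\dots+x_n^2=-1,\ x_0>0\}$ be hyperbolic space with its induced metric $b$. For $s\in\mathbb R$ let $\mathbb H^n_s=\{x\in\mathbb H^n:\ x_1\le s\}$, with boundary $\Sigma_s=\{x\in\mathbb H^n:\ x_1=s\}$ and inward unit normal $\nu=-\nabla x_1/|\nabla x_1|$ along $\Sigma_s$, and let $\theta\in(-\pi/2,\pi/2)$ be the angle with $\sin\theta=s/\sqrt{1+s^2}$. Let $\mathbb S$ be the complex spinor bundle (of rank $2^k$) of $(\mathbb H^n_s,b)$ for its unique spin structure, with Clifford multiplication $\mathfrak c$, $\mathfrak c(X)^2=-|X|^2$, and with the connection $\nabla$ induced by the Levi-Civita connection. Put $Q=\mathbf i^{k}\,\mathfrak c(e_1)\cdots\mathfrak c(e_n)$ for a positively oriented orthonormal frame $e_1,\dots,e_n$, and $Q_\theta=e^{\mathbf i\theta Q}Q\,\mathfrak c(\nu)$ along $\Sigma_s$. For each choice of the sign $\pm$ (the same sign in both conditions) let $\mathcal K^{b,\pm,(\pm)_\theta}(\mathbb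 S\mathbb H^n_s)$ be the complex vector space of smooth sections $\Phi$ of $\mathbb S$ over $\mathbb H^n_s$ (smooth up to the boundary) with $$\nabla_X\Phi\pm\tfrac{\mathbf i}{2}\mathfrak c(X)\Phi=0\quad\text{for all tangent vectors }X,\qquad Q_\theta\Phi=\pm\Phi\quad\text{along }\Sigma_s .$$ Then $$\dim_{\mathbb C}\mathcal K^{b,\pm,(\pm)_\theta}(\mathbb S\mathbb H^n_s)=2^{k-1}.$$ In particular, $\mathcal K^{b,\pm,(\pm)_\theta}(\mathbb S\mathbb H^n_s)\neq\{0\}$. -/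

import Mathlib

open scoped ContDiff

namespace HypSpin

noncomputable section

/-! ### The hyperboloid model and its global chart -/

/-- Euclidean space `ℝⁿ`. The coordinates `x₁, …, xₙ` of the text are indexed by `0, …, n - 1`. -/
abbrev Eucl (n : ℕ) : Type := EuclideanSpace ℝ (Fin n)

/-- Minkowski space `ℝ^{1,n}`; a point is written `(x₀, (x₁, …, xₙ))`. -/
abbrev Mink (n : ℕ) : Type := ℝ × Eucl n

/-- The flat Lorentzian metric `-x₀ y₀ + x₁ y₁ + ⋯ + xₙ yₙ`. -/
def minkInner {n : ℕ} (p q : Mink n) : ℝ := -(p.1 * q.1) + inner ℝ p.2 q.2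

/-- The region `ℍⁿ_s = {x ∈ ℍⁿ : x₁ ≤ s}` of hyperbolic space
`ℍⁿ = {x : ⟨x, x⟩ = -1, x₀ > 0}`, as a subset of Minkowski space. -/
def HypRegion (n : ℕ) [NeZero n] (s : ℝ) : Set (Mink n) :=
  {p | minkInner p p = -1 ∧ 0 < p.1 ∧ p.2 0 ≤ s}

/-- Inverse of the global chart `(x₀, x') ↦ x'` of `ℍⁿ`: the parametrization
`x' ↦ (√(1 + |x'|²), x')`. -/
def hypParam {n : ℕ} (x : Eucl n) : Mink n := (√(1 + ‖x‖ ^ 2), x)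

/-- The image of `ℍⁿ_s` in the global chart: the closed half-space `x₁ ≤ s`. -/
def halfSpace (n : ℕ) [NeZero n] (s : ℝ) : Set (Eucl n) := {x | x 0 ≤ s}

/-- The parametrization is a bijection from the half-space onto `ℍⁿ_s`. -/
theorem hypParam_bijOn (n : ℕ) [NeZero n] (s : ℝ) :
    Set.BijOn hypParam (halfSpace n s) (HypRegion n s) := by
  refine ⟨fun x hx => ?_, fun x _ y _ h => congrArg Prod.snd h, fun p hp => ?_⟩
  · have h0 : (0 : ℝ) < 1 + ‖x‖ ^ 2 := by positivity
    refine ⟨?_, Real.sqrt_pos.2 h0, hx⟩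
    simp only [minkInner, hypParam, Real.mul_self_sqrt h0.le, real_inner_self_eq_norm_sq]
    ring
  · obtain ⟨h1, h2, h3⟩ := hp
    refine ⟨p.2, h3, ?_⟩
    simp only [minkInner, real_inner_self_eq_norm_sq] at h1
    refine Prod.ext ?_ rfl
    have h4 : 1 + ‖p.2‖ ^ 2 = p.1 ^ 2 := by linarith [sq p.1]
    simp only [hypParam, h4, Real.sqrt_sq h2.le]

theorem halfSpace_uniqueDiffOn (n : ℕ) [NeZero n] (s : ℝ) :
    UniqueDiffOn ℝ (halfSpace n s) := by
  have hc : Continuous fun x : Eucl n => x 0 := by fun_prop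
  refine uniqueDiffOn_convex ?_ ?_
  · intro x hx y hy a b ha hb hab
    simp only [halfSpace, Set.mem_ofPred_eq, PiLp.add_apply, PiLp.smul_apply, smul_eq_mul]
      at hx hy ⊢
    have h1 : a * s + b * s = s := by rw [← add_mul, hab, one_mul]
    linarith [mul_le_mul_of_nonneg_left hx ha, mul_le_mul_of_nonneg_left hy hb]
  · refine ⟨EuclideanSpace.single 0 (s - 1), ?_⟩
    have ho : IsOpen {x : Eucl n | x 0 < s} := isOpen_lt hc continuous_const
    refine interior_maximal (s := halfSpace n s) (t := {x : Eucl n | x 0 < s})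
      (fun x hx => le_of_lt (show x 0 < s from hx)) ho ?_
    simp

/-! ### Riemannian metrics on `ℝⁿ` in coordinates, orthonormal frames -/

/-- The hyperbolic metric `b` in the global chart, that is, the pull-back of the Lorentzian metric:
`b_x(v, w) = ⟨dι_x v, dι_x w⟩` for the parametrization `ι`. -/
def hypMetric {n : ℕ} (x v w : Eucl n) : ℝ :=
  minkInner (fderiv ℝ hypParam x v) (fderiv ℝ hypParam x w)

/-- Christoffel symbols of the first kind of a metric `g` in coordinates:
`Γ(u, v; w) = ½ (∂_u g(v, w) + ∂_v g(u, w) - ∂_w g(u, v))` for constant `u, v, w`. -/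
def christoffel {n : ℕ} (g : Eucl n → Eucl n → Eucl n → ℝ) (x u v w : Eucl n) : ℝ :=
  (1 / 2) * (fderiv ℝ (fun z => g z v w) x u + fderiv ℝ (fun z => g z u w) x v
    - fderiv ℝ (fun z => g z u v) x w)

/-- `g(∇_u Y, w)` at `x`, where `∇` is the Levi-Civita connection of `g`. -/
def leviCivita {n : ℕ} (g : Eucl n → Eucl n → Eucl n → ℝ) (Y : Eucl n → Eucl n)
    (x u w : Eucl n) : ℝ :=
  g x (fderiv ℝ Y x u) w + christoffel g x u (Y x) w

/-- A smooth global orthonormal frame of `g`. -/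
structure OrthoFrame {n : ℕ} (g : Eucl n → Eucl n → Eucl n → ℝ) where
  vec : Fin n → Eucl n → Eucl n
  smooth : ∀ i, ContDiff ℝ ∞ (vec i)
  ortho : ∀ x i j, g x (vec i x) (vec j x) = if i = j then 1 else 0

/-- The gradient of `f` with respect to `g`, computed in an orthonormal frame. -/
def OrthoFrame.grad {n : ℕ} {g : Eucl n → Eucl n → Eucl n → ℝ} (E : OrthoFrame g)
    (f : Eucl n → ℝ) (x : Eucl n) : Eucl n :=
  ∑ i, fderiv ℝ f x (E.vec i x) • E.vec i x

theorem fderiv_hypParam_apply {n : ℕ} (x v : Eucl n) :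
    fderiv ℝ hypParam x v = (inner ℝ x v / √(1 + ‖x‖ ^ 2), v) := by
  have h0 : (1 : ℝ) + ‖x‖ ^ 2 ≠ 0 := by positivity
  have h1 : HasFDerivAt (fun y : Eucl n => 1 + ‖y‖ ^ 2) (2 • innerSL ℝ x) x :=
    (hasStrictFDerivAt_norm_sq x).hasFDerivAt.const_add 1
  have h2 := (h1.sqrt h0).prodMk (hasFDerivAt_id x)
  have h3 : fderiv ℝ (hypParam (n := n)) x = _ := h2.fderiv
  rw [h3]
  refine Prod.ext ?_ rfl
  simp only [ContinuousLinearMap.prod_apply, smul_apply, innerSL_apply_apply,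
    smul_eq_mul, nsmul_eq_mul]
  field_simp
  norm_num

/-- The orthonormal frame of `ℍⁿ` whose value at `x ∈ ℍⁿ` is the image of the standard basis
`∂₁, …, ∂ₙ` under the Lorentz boost taking `(1, 0)` to `x`, expressed in the global chart:
`E_i = ∂_i + x_i / (1 + x₀) • x'`. (In the Poincaré ball model this is the frame `Ω ∂_{y_i}`.) -/
def hypFrame (n : ℕ) : OrthoFrame (hypMetric (n := n)) where
  vec i x := EuclideanSpace.single i 1 + (x i / (1 + √(1 + ‖x‖ ^ 2))) • x
  smooth i := by
    have h0 : ∀ x : Eucl n, (1 : ℝ) + ‖x‖ ^ 2 ≠ 0 := fun x => by positivity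
    have h1 : ∀ x : Eucl n, (1 : ℝ) + √(1 + ‖x‖ ^ 2) ≠ 0 := fun x => by positivity
    have h2 : ContDiff ℝ ∞ fun x : Eucl n => √(1 + ‖x‖ ^ 2) :=
      (contDiff_const.add (contDiff_norm_sq ℝ)).sqrt h0
    have h3 : ContDiff ℝ ∞ fun x : Eucl n => x i := by fun_prop
    exact contDiff_const.add ((h3.div (contDiff_const.add h2) h1).smul contDiff_id)
  ortho x i j := by
    have hp : (0 : ℝ) < 1 + ‖x‖ ^ 2 := by positivity
    have hr : √(1 + ‖x‖ ^ 2) ^ 2 = 1 + ‖x‖ ^ 2 := Real.sq_sqrt hp.le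
    have hr0 : 0 < √(1 + ‖x‖ ^ 2) := Real.sqrt_pos.2 hp
    simp only [hypMetric, fderiv_hypParam_apply, minkInner, inner_add_left, inner_add_right,
      inner_smul_left, inner_smul_right, real_inner_self_eq_norm_sq,
      EuclideanSpace.inner_single_left, EuclideanSpace.inner_single_right]
    have hx : ‖x‖ ^ 2 = √(1 + ‖x‖ ^ 2) ^ 2 - 1 := by rw [hr]; ring
    generalize √(1 + ‖x‖ ^ 2) = r at *
    rw [hx]
    have hr1 : (1 : ℝ) + r ≠ 0 := by positivity
    simp only [PiLp.single_apply, eq_comm (a := j) (b := i)]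
    simp
    field_simp
    ring

/-! ### Spinors

For `n = 2k` the complex spinor module is a complex vector space `S` of dimension `2^k` with an
action `ρ` of the real Clifford algebra of `(ℝⁿ, -|·|²)` (equivalently, an irreducible complex
module of it; it is unique up to isomorphism). As `ℍⁿ_s` is contractible, it has exactly one spin
structure, and a global orthonormal frame `E` lifts to a global section of it. In the trivialization
of the spinor bundle given by this lift, spinor fields are `S`-valued functions, Clifford
multiplication by `E_i` is the constant operator `ρ(e_i)`, and the lift of the Levi-Civita
connection is `∇_X ψ = X(ψ) + ¼ ∑_{i,j} g(∇_X E_i, E_j) ρ(e_i) ρ(e_j) ψ`. -/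

/-- The quadratic form `v ↦ -|v|²` on `ℝⁿ`, so that `v · v = -|v|²` in its Clifford algebra. -/
def negForm (n : ℕ) : QuadraticForm ℝ (Fin n → ℝ) :=
  QuadraticMap.weightedSumSquares ℝ (fun _ : Fin n => (-1 : ℝ))

/-- A spinor field on `ℍⁿ_s` read in the global chart (and set to `0` outside the half-space). -/
def coordRep {n : ℕ} [NeZero n] {S : Type*} [AddCommGroup S] {s : ℝ} (Φ : HypRegion n s → S) : Eucl n → S :=
  Function.extend (fun p : HypRegion n s => p.1.2) Φ 0

theorem coordRep_add {n : ℕ} [NeZero n] {S : Type*} [AddCommGroup S] {s : ℝ} (Φ Ψ : HypRegion n s → S) :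
    coordRep (Φ + Ψ) = coordRep Φ + coordRep Ψ := by
  simpa [coordRep] using
    Function.extend_add (fun p : HypRegion n s => p.1.2) Φ Ψ (0 : Eucl n → S) 0

section Spinors

variable {n : ℕ} {S : Type*} [NormedAddCommGroup S] [NormedSpace ℂ S]

/-- Clifford multiplication `𝔠(X)` by the tangent vector `X` at `x`. -/
def cliff {g : Eucl n → Eucl n → Eucl n → ℝ} (E : OrthoFrame g)
    (ρ : CliffordAlgebra (negForm n) →ₐ[ℝ] (S →L[ℂ] S)) (x X : Eucl n) : S →L[ℂ] S :=
  ρ (CliffordAlgebra.ι (negForm n) (fun i => g x X (E.vec i x)))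

/-- The complex volume element `ω = i^{n/2} 𝔠(E₁) ⋯ 𝔠(Eₙ)` at `x`, for even `n`. -/
def chirality {g : Eucl n → Eucl n → Eucl n → ℝ} (E : OrthoFrame g)
    (ρ : CliffordAlgebra (negForm n) →ₐ[ℝ] (S →L[ℂ] S)) (x : Eucl n) : S →L[ℂ] S :=
  Complex.I ^ (n / 2) • (List.ofFn fun i => cliff E ρ x (E.vec i x)).prod

/-- The zeroth order part of the spinorial connection,
`¼ ∑_{i,j} g(∇_X E_i, E_j) 𝔠(E_i) 𝔠(E_j)`. -/
def spinConn {g : Eucl n → Eucl n → Eucl n → ℝ} (E : OrthoFrame g)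
    (ρ : CliffordAlgebra (negForm n) →ₐ[ℝ] (S →L[ℂ] S)) (x X : Eucl n) : S →L[ℂ] S :=
  (1 / 4 : ℂ) • ∑ i, ∑ j, (leviCivita g (E.vec i) x X (E.vec j x) : ℂ) •
    (cliff E ρ x (E.vec i x) * cliff E ρ x (E.vec j x))

/-- The covariant derivative `∇_X ψ` at `x` of a spinor field `ψ` on the coordinate domain `D`. -/
def spinDeriv {g : Eucl n → Eucl n → Eucl n → ℝ} (E : OrthoFrame g)
    (ρ : CliffordAlgebra (negForm n) →ₐ[ℝ] (S →L[ℂ] S)) (D : Set (Eucl n)) (ψ : Eucl n → S)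
    (x X : Eucl n) : S :=
  fderivWithin ℝ ψ D x X + spinConn E ρ x X (ψ x)

/-- The gradient `∇x₁` of the coordinate function `x₁` on `ℍⁿ`. -/
def gradX1 (n : ℕ) [NeZero n] (x : Eucl n) : Eucl n :=
  (hypFrame n).grad (fun z => z 0) x

/-- The unit normal of the level sets of `x₁` in `ℍⁿ` which points into `{x₁ ≤ s}`:
`ν = -∇x₁ / |∇x₁|`. -/
def inwardNormal (n : ℕ) [NeZero n] (x : Eucl n) : Eucl n :=
  -((√(hypMetric x (gradX1 n x) (gradX1 n x)))⁻¹ • gradX1 n x)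

/-- The boundary operator `Q_θ = e^{iθQ} Q 𝔠(ν)` at a point `x` of `Σ_s`. -/
def thetaOp [NeZero n] (ρ : CliffordAlgebra (negForm n) →ₐ[ℝ] (S →L[ℂ] S)) (θ : ℝ)
    (x : Eucl n) : S →L[ℂ] S :=
  NormedSpace.exp ((Complex.I * θ) • chirality (hypFrame n) ρ x) *
    chirality (hypFrame n) ρ x * cliff (hypFrame n) ρ x (inwardNormal n x)

theorem coordRep_smul [NeZero n] {s : ℝ} (a : ℂ) (Φ : HypRegion n s → S) :
    coordRep (a • Φ) = a • coordRep Φ := by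
  simpa [coordRep] using
    Function.extend_smul a (fun p : HypRegion n s => p.1.2) Φ (0 : Eucl n → S)

theorem coordRep_zero [NeZero n] {s : ℝ} :
    coordRep (0 : HypRegion n s → S) = 0 := by
  simpa using coordRep_smul (0 : ℂ) (0 : HypRegion n s → S)

/-- The space `𝒦^{b,±}(𝕊ℍⁿ_s)` of imaginary Killing spinors: smooth spinor fields `Φ` on `ℍⁿ_s`
(up to the boundary) with `∇_X Φ ± (i/2) 𝔠(X) Φ = 0` for all tangent vectors `X`. The sign is `ε`. -/
def killingSpinors [NeZero n] (ρ : CliffordAlgebra (negForm n) →ₐ[ℝ] (S →L[ℂ] S)) (s : ℝ)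
    (ε : ℤˣ) : Submodule ℂ (HypRegion n s → S) where
  carrier := {Φ | ContDiffOn ℝ ∞ (coordRep Φ) (halfSpace n s) ∧
    ∀ x ∈ halfSpace n s, ∀ X : Eucl n,
      spinDeriv (hypFrame n) ρ (halfSpace n s) (coordRep Φ) x X
        + (((ε : ℤ) : ℂ) * (Complex.I / 2)) • cliff (hypFrame n) ρ x X (coordRep Φ x) = 0}
  zero_mem' := by
    simp only [Set.mem_ofPred_eq, coordRep_zero, spinDeriv]
    refine ⟨contDiffOn_const, fun x _ X => ?_⟩
    simp [show (0 : Eucl n → S) = fun _ => 0 from rfl]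
  add_mem' := by
    rintro Φ Ψ ⟨h1, h2⟩ ⟨h3, h4⟩
    simp only [Set.mem_ofPred_eq, coordRep_add, spinDeriv] at *
    refine ⟨h1.add h3, fun x hx X => ?_⟩
    have hu := halfSpace_uniqueDiffOn n s x hx
    have d1 := (h1.differentiableOn (by simp)) x hx
    have d2 := (h3.differentiableOn (by simp)) x hx
    rw [fderivWithin_add hu d1 d2]
    simp only [Pi.add_apply, map_add, smul_add, add_apply]
    have h5 := congrArg₂ (· + ·) (h2 x hx X) (h4 x hx X)
    simp only [add_zero] at h5
    refine Eq.trans ?_ h5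
    abel
  smul_mem' := by
    rintro a Φ ⟨h1, h2⟩
    simp only [Set.mem_ofPred_eq, coordRep_smul, spinDeriv] at *
    refine ⟨h1.const_smul a, fun x hx X => ?_⟩
    have hu := halfSpace_uniqueDiffOn n s x hx
    have d1 := (h1.differentiableOn (by simp)) x hx
    rw [fderivWithin_const_smul hu d1]
    have := congrArg (a • ·) (h2 x hx X)
    simp only [smul_add, smul_zero] at this
    simp only [Pi.smul_apply, map_smul, smul_apply]
    rw [smul_comm _ a]
    exact this

/-- The space `𝒦^{b,±,(±)_θ}(𝕊ℍⁿ_s)` of imaginary Killing spinors which satisfy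
the boundary condition `Q_θ Φ = ±Φ` along `Σ_s = {x₁ = s}`, with the same sign `ε` in both. -/
def thetaKillingSpinors [NeZero n] (ρ : CliffordAlgebra (negForm n) →ₐ[ℝ] (S →L[ℂ] S)) (s θ : ℝ)
    (ε : ℤˣ) : Submodule ℂ (HypRegion n s → S) where
  carrier := {Φ | Φ ∈ killingSpinors ρ s ε ∧
    ∀ p : HypRegion n s, p.1.2 0 = s → thetaOp ρ θ p.1.2 (Φ p) = ((ε : ℤ) : ℂ) • Φ p}
  zero_mem' := ⟨Submodule.zero_mem _, by simp⟩
  add_mem' := by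
    rintro Φ Ψ ⟨h1, h2⟩ ⟨h3, h4⟩
    refine ⟨Submodule.add_mem _ h1 h3, fun p hp => ?_⟩
    simp [h2 p hp, h4 p hp]
  smul_mem' := by
    rintro a Φ ⟨h1, h2⟩
    refine ⟨Submodule.smul_mem _ a h1, fun p hp => ?_⟩
    simp only [Pi.smul_apply, map_smul, h2 p hp]
    rw [smul_comm]

end Spinors

end

end HypSpin

/-! Write r = x₀, p = √(1 + r), κ = ±i, and let c(x) be the constant Clifford action of x' on S. In
the boosted frame the spin connection is [c(x), c(v)] / (4(1 + r)). The operators M_κ = p - (κ/p)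
c(x), `killingMap`, solve the Killing equation column by column (`killing_identity`), and M_κ M_{-κ}
= 2, so they are invertible. Writing a spinor as M_κ φ turns the Killing equation into dφ = 0. Hence
Killing spinors are exactly M_κ u with u constant (`mem_killingSpinors_iff`).

Let Q be the volume element, e = c(e₁), and ε = ±1, κ = εi. Since sin θ = s cos θ and cos θ = 1/√(1
+ s²), `boundary_identity` becomes, along x₁ = s, Q_θ M_κ = ε M_κ - ε cos²θ (Q + is) M_{-κ} (Q +
εe). Both Q + is and M_{-κ} are invertible, so the boundary condition reads (Q + εe) u = 0, that is,
Q e u = -ε u. This no longer involves the boundary point, s or θ (`thetaOp_killingMap_iff`). Finally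
Q e is an involution anticommuting with the involution Q, so its eigenspaces have half the dimension
of S (`two_mul_finrank_ker_of_anticomm`). -/

namespace HypSpin

noncomputable section

/-! ### Anticommuting generators, involutions and their eigenspaces -/

section Algebra

variable {A : Type*} [Ring A] {ι : Type*} [DecidableEq ι] {e : ι → A}

/-- Each factor different from `e j` contributes a sign and each copy of `e j` none. The number of
signs is length minus count; the sum has the same parity and avoids natural subtraction. -/
theorem list_prod_mul_anticomm (h : ∀ i j, i ≠ j → e i * e j = -(e j * e i)) (l : List ι) (j : ι) :
    (l.map e).prod * e j = (-1) ^ (l.length + l.count j) * (e j * (l.map e).prod) := by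
  induction l with
  | nil => simp
  | cons i l ih =>
    rw [List.map_cons, List.prod_cons, mul_assoc, ih, List.length_cons]
    have hc : ∀ (a : ℕ) (x : A), x * (-1) ^ a = (-1) ^ a * x := fun a x =>
      ((Commute.neg_one_left x).pow_left a).symm.eq
    rw [← mul_assoc, hc, mul_assoc]
    by_cases hij : i = j
    · subst hij
      rw [List.count_cons_self, show l.length + 1 + (l.count i + 1) = l.length + l.count i + 2 by ring,
        pow_add _ _ 2]
      simp
    · rw [List.count_cons_of_ne hij, ← mul_assoc (e i), h i j hij,
        show l.length + 1 + l.count j = l.length + l.count j + 1 by ring, pow_succ]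
      simp [mul_assoc]

/-- Moving the head past a tail of length m costs m signs and squaring it one more, so the exponents
add up to 1 + 2 + ⋯ over the list. -/
theorem list_prod_mul_self_of_anticomm (h : ∀ i j, i ≠ j → e i * e j = -(e j * e i))
    (h1 : ∀ i, e i * e i = -1) (l : List ι) (hl : l.Nodup) :
    (l.map e).prod * (l.map e).prod = (-1) ^ ((l.length + 1).choose 2) := by
  induction l with
  | nil => simp
  | cons i l ih =>
    obtain ⟨hi, hl⟩ := List.nodup_cons.1 hl
    have hp := list_prod_mul_anticomm h l i
    rw [List.count_eq_zero_of_not_mem hi, add_zero] at hp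
    have hc : ∀ (a : ℕ) (x : A), x * (-1) ^ a = (-1) ^ a * x := fun a x =>
      ((Commute.neg_one_left x).pow_left a).symm.eq
    rw [List.map_cons, List.prod_cons, mul_assoc, ← mul_assoc _ (e i), hp, mul_assoc, ← mul_assoc,
      hc, mul_assoc, mul_assoc, ih hl, ← mul_assoc (e i), h1, List.length_cons,
      Nat.choose_succ_succ' (l.length + 1) 1, Nat.choose_one_right, pow_add, pow_succ]
    simp

/-- The product of the generators over `Fin n` anticommutes with each of them when `n` is even. -/
theorem prod_ofFn_mul_anticomm {n : ℕ} {e : Fin n → A} (hn : Even n)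
    (h : ∀ i j, i ≠ j → e i * e j = -(e j * e i)) (j : Fin n) :
    (List.ofFn e).prod * e j = -(e j * (List.ofFn e).prod) := by
  have := list_prod_mul_anticomm h (List.finRange n) j
  rw [List.length_finRange, List.count_eq_one_of_mem (List.nodup_finRange n) (List.mem_finRange j),
    ← List.ofFn_eq_map, pow_succ, hn.neg_one_pow] at this
  simpa using this

theorem prod_ofFn_mul_self_of_anticomm {n : ℕ} {e : Fin n → A}
    (h : ∀ i j, i ≠ j → e i * e j = -(e j * e i)) (h1 : ∀ i, e i * e i = -1) :
    (List.ofFn e).prod * (List.ofFn e).prod = (-1) ^ ((n + 1).choose 2) := by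
  have := list_prod_mul_self_of_anticomm h h1 (List.finRange n) (List.nodup_finRange n)
  rwa [List.length_finRange, ← List.ofFn_eq_map] at this

end Algebra

/-- Euler's formula for an involution. -/
theorem exp_smul_of_mul_self_eq_one {A : Type*} [NormedRing A] [NormedAlgebra ℂ A] {Q : A}
    (hQ : Q * Q = 1) (θ : ℝ) :
    NormedSpace.exp ((Complex.I * θ) • Q) =
      (Real.cos θ : ℂ) • (1 : A) + (Complex.I * Real.sin θ) • Q := by
  -- The idempotents (1 ± Q)/2 split the exponential series into those of exp(iθ) and exp(-iθ).
  have hpow : ∀ j : ℕ, Q ^ j = (1 / 2 : ℂ) • (1 + Q) + ((-1) ^ j : ℂ) • (1 / 2 : ℂ) • (1 - Q) := by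
    intro j
    induction j with
    | zero => simp only [pow_zero]; module
    | succ j ih =>
      rw [pow_succ, ih]
      simp only [add_mul, smul_mul_assoc, sub_mul, one_mul, hQ, pow_succ]
      module
  have hs : ∀ z : ℂ, HasSum (fun j : ℕ => (j.factorial : ℂ)⁻¹ • z ^ j) (Complex.exp z) := fun z => by
    rw [Complex.exp_eq_exp_ℂ]
    exact NormedSpace.exp_series_hasSum_exp' (𝕂 := ℂ) z
  have h := ((hs (Complex.I * θ)).smul_const ((1 / 2 : ℂ) • (1 + Q))).add
    ((hs (-(Complex.I * θ))).smul_const ((1 / 2 : ℂ) • (1 - Q)))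
  rw [NormedSpace.exp_eq_tsum ℂ]
  have h2 := h.tsum_eq
  have e1 : Complex.exp (Complex.I * θ) = Real.cos θ + Complex.I * Real.sin θ := by
    rw [mul_comm, Complex.exp_mul_I]; push_cast; ring
  have e2 : Complex.exp (-(Complex.I * θ)) = Real.cos θ - Complex.I * Real.sin θ := by
    rw [mul_comm, ← neg_mul, mul_comm, mul_neg, ← mul_neg, mul_comm, Complex.exp_mul_I,
      Complex.cos_neg, Complex.sin_neg]
    push_cast; ring
  rw [e1, e2] at h2
  have h3 : ∀ a b : ℂ, a • (1 : A) + b • Q =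
      (a + b) • (1 / 2 : ℂ) • (1 + Q) + (a - b) • (1 / 2 : ℂ) • (1 - Q) := fun a b => by module
  rw [h3, ← h2]
  refine tsum_congr fun j => ?_
  rw [smul_pow, hpow, neg_pow]
  simp only [smul_eq_mul]
  module

/-- If an involution `P` anticommutes with an involution `Q`, its eigenspaces are of half the
dimension. -/
theorem two_mul_finrank_ker_of_anticomm {S : Type*} [AddCommGroup S] [Module ℂ S]
    [FiniteDimensional ℂ S] (P Q : Module.End ℂ S) (hP : P * P = 1) (hQ : Q * Q = 1)
    (hPQ : P * Q = -(Q * P)) (ε : ℂ) (hε : ε * ε = 1) :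
    2 * Module.finrank ℂ (LinearMap.ker (P - ε • 1)) = Module.finrank ℂ S := by
  have aP : ∀ v, P (P v) = v := fun v => LinearMap.congr_fun hP v
  have aQ : ∀ v, Q (Q v) = v := fun v => LinearMap.congr_fun hQ v
  have aPQ : ∀ v, P (Q v) = -Q (P v) := fun v => LinearMap.congr_fun hPQ v
  have mem : ∀ (c : ℂ) v, v ∈ LinearMap.ker (P - c • 1) ↔ P v = c • v := fun c v => by
    simp [LinearMap.mem_ker, sub_eq_zero]
  have hQmem : ∀ (c : ℂ) v, v ∈ LinearMap.ker (P - c • 1) →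
      Q v ∈ LinearMap.ker (P - (-c) • 1) := fun c v hv => by
    rw [mem] at hv ⊢; rw [aPQ, hv, map_smul, neg_smul]
  -- Q exchanges the two eigenspaces injectively; using this for ε and -ε gives equal dimensions.
  have hle : ∀ c : ℂ, Module.finrank ℂ (LinearMap.ker (P - c • 1)) ≤
      Module.finrank ℂ (LinearMap.ker (P - (-c) • 1)) := fun c => by
    refine LinearMap.finrank_le_finrank_of_injective (f := Q.restrict (hQmem c)) fun a b hab => ?_
    have := congrArg (fun z => Q z.1) hab
    simp only [LinearMap.coe_restrict_apply, aQ] at this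
    exact Subtype.ext this
  have heq := le_antisymm (hle ε) ((hle (-ε)).trans_eq (by rw [neg_neg]))
  have hc : IsCompl (LinearMap.ker (P - ε • 1)) (LinearMap.ker (P - (-ε) • 1)) := by
    constructor
    · rw [Submodule.disjoint_def]
      intro v h1 h2
      rw [mem] at h1 h2
      have h4 : (2 * ε) • v = 0 := by linear_combination (norm := module) h2 - h1
      have : (2 * ε) ≠ 0 := mul_ne_zero two_ne_zero (left_ne_zero_of_mul_eq_one hε)
      exact (smul_eq_zero.1 h4).resolve_left this
    · rw [codisjoint_iff_le_sup]
      intro v _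
      have hv : v = (1 / 2 : ℂ) • (v + ε • P v) + (1 / 2 : ℂ) • (v - ε • P v) := by module
      rw [hv]
      refine Submodule.add_mem_sup ?_ ?_
      · rw [mem]; simp only [map_smul, map_add, aP]
        linear_combination (norm := module) (-(1/2:ℂ)) • congrArg (· • P v) hε
      · rw [mem]; simp only [map_smul, map_sub, aP]
        linear_combination (norm := module) (-(1/2:ℂ)) • congrArg (· • P v) hε
  have := Submodule.finrank_add_eq_of_isCompl hc
  omega

/-! ### The hyperbolic metric and its Levi-Civita connection in the global chart -/

section Metric

variable {n : ℕ}

theorem hypMetric_apply (x v w : Eucl n) :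
    hypMetric x v w = inner ℝ v w - inner ℝ x v * inner ℝ x w / (1 + ‖x‖ ^ 2) := by
  have hp : (0 : ℝ) < 1 + ‖x‖ ^ 2 := by positivity
  simp only [hypMetric, minkInner, fderiv_hypParam_apply]
  rw [div_mul_div_comm, Real.mul_self_sqrt hp.le]
  ring

theorem fderiv_hypMetric (x v w u : Eucl n) :
    fderiv ℝ (fun z => hypMetric z v w) x u =
      -(inner ℝ u v * inner ℝ x w + inner ℝ x v * inner ℝ u w) / (1 + ‖x‖ ^ 2)
        + 2 * inner ℝ x v * inner ℝ x w * inner ℝ x u / (1 + ‖x‖ ^ 2) ^ 2 := by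
  have hp : (1 : ℝ) + ‖x‖ ^ 2 ≠ 0 := by positivity
  simp only [hypMetric_apply]
  have h1 : HasFDerivAt (fun y : Eucl n => 1 + ‖y‖ ^ 2) (2 • innerSL ℝ x) x :=
    (hasStrictFDerivAt_norm_sq x).hasFDerivAt.const_add 1
  have hl : ∀ a : Eucl n, HasFDerivAt (fun z : Eucl n => inner ℝ z a) (innerSL ℝ a) x := fun a => by
    have := (innerSL ℝ a).hasFDerivAt (x := x)
    refine this.congr_of_eventuallyEq (Filter.Eventually.of_forall fun z => ?_)
    simp [real_inner_comm]
  have h := (((hl v).mul (hl w)).mul ((hasDerivAt_inv hp).comp_hasFDerivAt x h1)).const_sub (inner ℝ v w)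
  have h' : HasFDerivAt (fun z => inner ℝ v w - inner ℝ z v * inner ℝ z w / (1 + ‖z‖ ^ 2)) _ x :=
    h.congr_of_eventuallyEq (Filter.Eventually.of_forall fun z => by simp [div_eq_mul_inv])
  rw [h'.fderiv]
  simp [real_inner_comm]
  field_simp
  ring

/-- The second derivative of the parametrization ι is (b(u, v)/r, 0) with r = √(1 + |x|²), and the
symbol is its Lorentz product with dι(w) = (⟨x, w⟩/r, w). -/
theorem christoffel_hypMetric (x u v w : Eucl n) :
    christoffel hypMetric x u v w = -(hypMetric x u v * inner ℝ x w) / (1 + ‖x‖ ^ 2) := by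
  have hp : (1 : ℝ) + ‖x‖ ^ 2 ≠ 0 := by positivity
  simp only [christoffel, fderiv_hypMetric]
  rw [hypMetric_apply]
  rw [real_inner_comm u v, real_inner_comm u w, real_inner_comm v w]
  field_simp
  ring

theorem hasFDerivAt_sqrt_one_add_norm_sq (x : Eucl n) :
    HasFDerivAt (fun y : Eucl n => √(1 + ‖y‖ ^ 2)) ((√(1 + ‖x‖ ^ 2))⁻¹ • innerSL ℝ x) x := by
  have hp : (1 : ℝ) + ‖x‖ ^ 2 ≠ 0 := by positivity
  have h1 : HasFDerivAt (fun y : Eucl n => 1 + ‖y‖ ^ 2) (2 • innerSL ℝ x) x :=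
    (hasStrictFDerivAt_norm_sq x).hasFDerivAt.const_add 1
  refine (h1.sqrt hp).congr_fderiv ?_
  ext v
  simp
  field_simp

theorem fderiv_hypFrame_vec (i : Fin n) (x u : Eucl n) :
    fderiv ℝ ((hypFrame n).vec i) x u =
      (u i / (1 + √(1 + ‖x‖ ^ 2))
        - x i * inner ℝ x u / (√(1 + ‖x‖ ^ 2) * (1 + √(1 + ‖x‖ ^ 2)) ^ 2)) • x
        + (x i / (1 + √(1 + ‖x‖ ^ 2))) • u := by
  have hm : (1 : ℝ) + √(1 + ‖x‖ ^ 2) ≠ 0 := by positivity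
  have hr : √(1 + ‖x‖ ^ 2) ≠ 0 := by positivity
  have hc : HasFDerivAt (fun z : Eucl n => z i) (EuclideanSpace.proj i : Eucl n →L[ℝ] ℝ) x :=
    (EuclideanSpace.proj i : Eucl n →L[ℝ] ℝ).hasFDerivAt
  have h := ((hc.mul ((hasDerivAt_inv hm).comp_hasFDerivAt x
    ((hasFDerivAt_sqrt_one_add_norm_sq x).const_add 1))).smul
    (hasFDerivAt_id x)).const_add (EuclideanSpace.single i (1 : ℝ))
  have h' : HasFDerivAt ((hypFrame n).vec i) _ x :=
    h.congr_of_eventuallyEq (Filter.Eventually.of_forall fun z => by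
      simp [hypFrame, div_eq_mul_inv])
  rw [h'.fderiv]
  simp
  rw [add_comm]
  congr 2
  field_simp
  ring

/-- The components of a tangent vector in the frame `hypFrame`. -/
theorem hypMetric_vec (x v : Eucl n) (i : Fin n) :
    hypMetric x v ((hypFrame n).vec i x) =
      v i - inner ℝ x v * x i / (√(1 + ‖x‖ ^ 2) * (1 + √(1 + ‖x‖ ^ 2))) := by
  have hp : (0 : ℝ) < 1 + ‖x‖ ^ 2 := by positivity
  have hr : √(1 + ‖x‖ ^ 2) ^ 2 = 1 + ‖x‖ ^ 2 := Real.sq_sqrt hp.le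
  have hr0 : 0 < √(1 + ‖x‖ ^ 2) := Real.sqrt_pos.2 hp
  have hx : ‖x‖ ^ 2 = √(1 + ‖x‖ ^ 2) ^ 2 - 1 := by rw [hr]; ring
  rw [hypMetric_apply]
  simp only [hypFrame, inner_add_right, inner_smul_right, EuclideanSpace.inner_single_right,
    real_inner_self_eq_norm_sq]
  rw [real_inner_comm v x]
  generalize √(1 + ‖x‖ ^ 2) = r at *
  rw [← hr, hx]
  have hr1 : (1 : ℝ) + r ≠ 0 := by positivity
  simp
  field_simp
  ring

/-- The connection coefficients of `hypFrame`. -/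
theorem leviCivita_hypFrame (x u : Eucl n) (i j : Fin n) :
    leviCivita hypMetric ((hypFrame n).vec i) x u ((hypFrame n).vec j x) =
      (x i * u j - u i * x j) / (1 + √(1 + ‖x‖ ^ 2)) := by
  have hp : (0 : ℝ) < 1 + ‖x‖ ^ 2 := by positivity
  have hr : √(1 + ‖x‖ ^ 2) ^ 2 = 1 + ‖x‖ ^ 2 := Real.sq_sqrt hp.le
  have hr0 : 0 < √(1 + ‖x‖ ^ 2) := Real.sqrt_pos.2 hp
  have hx : ‖x‖ ^ 2 = √(1 + ‖x‖ ^ 2) ^ 2 - 1 := by rw [hr]; ring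
  have hE : inner ℝ x ((hypFrame n).vec j x) = x j * √(1 + ‖x‖ ^ 2) := by
    simp only [hypFrame, inner_add_right, inner_smul_right, EuclideanSpace.inner_single_right,
      real_inner_self_eq_norm_sq]
    generalize √(1 + ‖x‖ ^ 2) = r at *
    rw [hx]
    have hr1 : (1 : ℝ) + r ≠ 0 := by positivity
    simp
    field_simp
    ring
  rw [leviCivita, christoffel_hypMetric, hypMetric_vec, hypMetric_vec, fderiv_hypFrame_vec, hE]
  simp only [inner_add_right, inner_smul_right, real_inner_self_eq_norm_sq]
  generalize √(1 + ‖x‖ ^ 2) = r at *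
  rw [← hr, hx]
  have hr1 : (1 : ℝ) + r ≠ 0 := by positivity
  simp
  field_simp
  ring

end Metric

/-! ### Clifford multiplication in the frame trivialization -/

section Clifford

variable {n : ℕ} {S : Type*} [NormedAddCommGroup S] [NormedSpace ℂ S]
  (ρ : CliffordAlgebra (negForm n) →ₐ[ℝ] (S →L[ℂ] S))

/-- Constant Clifford multiplication by a vector of `ℝⁿ`. -/
def flatCliff : Eucl n →L[ℝ] (S →L[ℂ] S) :=
  LinearMap.toContinuousLinearMap (ρ.toLinearMap ∘ₗ CliffordAlgebra.ι (negForm n) ∘ₗ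
    (WithLp.linearEquiv 2 ℝ (Fin n → ℝ)).toLinearMap)

theorem flatCliff_apply (v : Eucl n) :
    flatCliff ρ v = ρ (CliffordAlgebra.ι (negForm n) (fun i => v i)) := rfl

theorem flatCliff_mul_self (v : Eucl n) :
    flatCliff ρ v * flatCliff ρ v = (-(‖v‖ ^ 2 : ℝ) : ℂ) • (1 : S →L[ℂ] S) := by
  rw [flatCliff_apply, ← map_mul, CliffordAlgebra.ι_sq_scalar, AlgHom.commutes,
    Algebra.algebraMap_eq_smul_one, EuclideanSpace.real_norm_sq_eq, ← Complex.ofReal_neg,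
    Complex.coe_smul]
  congr 1
  simp [negForm, QuadraticMap.weightedSumSquares_apply, sq]

theorem flatCliff_mul_add (v w : Eucl n) :
    flatCliff ρ v * flatCliff ρ w + flatCliff ρ w * flatCliff ρ v =
      (-2 * (inner ℝ v w : ℝ) : ℂ) • (1 : S →L[ℂ] S) := by
  have h := flatCliff_mul_self ρ (v + w)
  rw [map_add, add_mul, mul_add, mul_add, flatCliff_mul_self, flatCliff_mul_self,
    norm_add_sq_real] at h
  push_cast at h
  linear_combination (norm := module) h

theorem flatCliff_eq_sum (v : Eucl n) :
    flatCliff ρ v = ∑ i, (v i : ℂ) • flatCliff ρ (EuclideanSpace.single i 1) := by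
  conv_lhs => rw [← (EuclideanSpace.basisFun (Fin n) ℝ).sum_repr v]
  simp

/-- Frame components are taken by the inverse boost, which contracts the radial direction by 1/r, r
= √(1 + |x|²), and fixes its Euclidean complement. -/
theorem cliff_hypFrame (x v : Eucl n) :
    cliff (hypFrame n) ρ x v = flatCliff ρ v
      - ((inner ℝ x v / (√(1 + ‖x‖ ^ 2) * (1 + √(1 + ‖x‖ ^ 2))) : ℝ) : ℂ) • flatCliff ρ x := by
  rw [Complex.coe_smul, ← map_smul, ← map_sub, flatCliff_apply, cliff]
  congr 2
  funext i
  rw [hypMetric_vec]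
  simp
  ring

theorem cliff_hypFrame_vec (x : Eucl n) (i : Fin n) :
    cliff (hypFrame n) ρ x ((hypFrame n).vec i x) = flatCliff ρ (EuclideanSpace.single i 1) := by
  rw [cliff, flatCliff_apply]
  congr 2
  funext j
  rw [(hypFrame n).ortho]
  simp [PiLp.single_apply, eq_comm]

theorem spinConn_hypFrame (x v : Eucl n) :
    spinConn (hypFrame n) ρ x v = (1 / (4 * (1 + √(1 + ‖x‖ ^ 2))) : ℂ) •
      (flatCliff ρ x * flatCliff ρ v - flatCliff ρ v * flatCliff ρ x) := by
  simp only [spinConn, leviCivita_hypFrame, cliff_hypFrame_vec]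
  have hs : ∀ a b : Eucl n, flatCliff ρ a * flatCliff ρ b = ∑ i, ∑ j, ((a i : ℂ) * b j) •
      (flatCliff ρ (EuclideanSpace.single i 1) * flatCliff ρ (EuclideanSpace.single j 1)) := by
    intro a b
    rw [flatCliff_eq_sum ρ a, flatCliff_eq_sum ρ b, Finset.sum_mul_sum]
    simp only [smul_mul_smul_comm]
  rw [hs, hs, ← Finset.sum_sub_distrib, Finset.smul_sum, Finset.smul_sum]
  refine Finset.sum_congr rfl fun i _ => ?_
  rw [← Finset.sum_sub_distrib, Finset.smul_sum, Finset.smul_sum]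
  refine Finset.sum_congr rfl fun j _ => ?_
  rw [← sub_smul, smul_smul, smul_smul]
  congr 1
  push_cast
  have hm : (1 + √(1 + ‖x‖ ^ 2) : ℂ) ≠ 0 := by
    exact_mod_cast (by positivity : (1 : ℝ) + √(1 + ‖x‖ ^ 2) ≠ 0)
  field_simp

/-- The complex volume element in the frame trivialization. -/
def flatVolume : S →L[ℂ] S :=
  Complex.I ^ (n / 2) • (List.ofFn fun i => flatCliff ρ (EuclideanSpace.single i 1)).prod

theorem chirality_hypFrame (x : Eucl n) : chirality (hypFrame n) ρ x = flatVolume ρ := by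
  simp only [chirality, cliff_hypFrame_vec, flatVolume]

theorem flatCliff_single_mul_self (i : Fin n) :
    flatCliff ρ (EuclideanSpace.single i 1) * flatCliff ρ (EuclideanSpace.single i 1) = -1 := by
  rw [flatCliff_mul_self]
  simp

theorem flatCliff_single_anticomm (i j : Fin n) (hij : i ≠ j) :
    flatCliff ρ (EuclideanSpace.single i 1) * flatCliff ρ (EuclideanSpace.single j 1) =
      -(flatCliff ρ (EuclideanSpace.single j 1) * flatCliff ρ (EuclideanSpace.single i 1)) := by
  rw [eq_neg_iff_add_eq_zero, flatCliff_mul_add]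
  simp [EuclideanSpace.inner_single_left, hij]

/-- For n = 2k the squared product is (-1)^{k(2k+1)} = (-1)^k, which the square of the factor i^k
cancels. -/
theorem flatVolume_mul_self (hn : Even n) : flatVolume ρ * flatVolume ρ = 1 := by
  obtain ⟨k, rfl⟩ := hn
  rw [flatVolume, smul_mul_smul_comm, prod_ofFn_mul_self_of_anticomm
    (flatCliff_single_anticomm ρ) (flatCliff_single_mul_self ρ), ← two_mul,
    Nat.mul_div_cancel_left k two_pos, Nat.choose_two_right, Nat.add_sub_cancel, mul_comm _ (2 * k),
    mul_assoc 2, Nat.mul_div_cancel_left _ two_pos, ← mul_pow, Complex.I_mul_I, mul_comm k, pow_mul,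
    Odd.neg_one_pow ⟨k, rfl⟩]
  rcases Nat.even_or_odd k with h | h <;> simp [h.neg_one_pow]

theorem flatVolume_mul_flatCliff (hn : Even n) (v : Eucl n) :
    flatVolume ρ * flatCliff ρ v = -(flatCliff ρ v * flatVolume ρ) := by
  have h := prod_ofFn_mul_anticomm hn (flatCliff_single_anticomm ρ)
  rw [flatCliff_eq_sum ρ v, Finset.mul_sum, Finset.sum_mul, ← Finset.sum_neg_distrib]
  refine Finset.sum_congr rfl fun i _ => ?_
  rw [flatVolume, smul_mul_smul_comm, h, smul_mul_smul_comm, mul_comm, smul_neg]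

end Clifford

/-! ### Imaginary Killing spinors on the half-space -/

/-- The Clifford algebra identity behind the Killing equation. -/
theorem killing_identity {A : Type*} [Ring A] [Algebra ℂ A] (a b : A) (r t p κ : ℂ)
    (ha : a * a = (-(r ^ 2 - 1)) • (1 : A)) (hab : a * b + b * a = (-2 * t) • (1 : A))
    (hp : p ^ 2 = 1 + r) (hp0 : p ≠ 0) (hr0 : r ≠ 0) (hκ : κ * κ = -1) :
    ((t / (2 * p * r)) • (1 : A) + (κ * t / (2 * p ^ 3 * r)) • a - (κ / p) • b)
      + (1 / (4 * (1 + r))) • (a * b - b * a) * (p • (1 : A) - (κ / p) • a)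
      + (κ / 2) • (b - (t / (r * (1 + r))) • a) * (p • (1 : A) - (κ / p) • a) = 0 := by
  -- These rules reduce every word to 1, a, b or a b, leaving four scalar identities. Eliminating r
  -- in favour of p removes the relation between them.
  have hba : b * a = (-2 * t) • (1 : A) - a * b := eq_sub_of_add_eq' hab
  have haab : a * (a * b) = (-(r ^ 2 - 1)) • b := by rw [← mul_assoc, ha]; simp
  have haba : a * b * a = (-2 * t) • a - a * (a * b) := by
    rw [mul_assoc, hba, mul_sub]; simp
  have hbaa : b * a * a = (-(r ^ 2 - 1)) • b := by rw [mul_assoc, ha]; simp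
  simp only [mul_sub, sub_mul, smul_mul_smul_comm, smul_sub, mul_one, haba, hbaa, haab, ha,
    smul_smul]
  rw [hba]
  obtain rfl : r = p ^ 2 - 1 := by rw [hp]; ring
  rw [show 1 + (p ^ 2 - 1) = p ^ 2 by ring]
  match_scalars
  all_goals field_simp
  · linear_combination (4 * t * p ^ 4) * hκ
  · ring
  · ring
  · linear_combination 4 * hκ

theorem coordRep_apply {n : ℕ} [NeZero n] {S : Type*} [AddCommGroup S] {s : ℝ}
    (Φ : HypRegion n s → S) (p : HypRegion n s) :
    coordRep Φ p.1.2 = Φ p := by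
  have hinj : Function.Injective (fun p : HypRegion n s => p.1.2) := by
    intro p q h'
    refine Subtype.ext ?_
    obtain ⟨x, hx, hxp⟩ := (hypParam_bijOn n s).surjOn p.2
    obtain ⟨y, hy, hyq⟩ := (hypParam_bijOn n s).surjOn q.2
    simp only [← hxp, ← hyq] at h' ⊢
    rw [show x = y from h']
  exact hinj.extend_apply Φ 0 p

theorem intUnits_coe_mul_self (ε : ℤˣ) : ((ε : ℤ) : ℂ) * ((ε : ℤ) : ℂ) = 1 := by
  rw [← Int.cast_mul, ← Units.val_mul, Int.units_mul_self, Units.val_one, Int.cast_one]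

section

variable {n : ℕ} {S : Type*} [NormedAddCommGroup S] [NormedSpace ℂ S]
  (ρ : CliffordAlgebra (negForm n) →ₐ[ℝ] (S →L[ℂ] S))

/-- The map whose columns are the imaginary Killing spinors:
`√(1 + x₀) (1 - κ 𝔠(y))`, where `y = x' / (1 + x₀)` is the point of the Poincaré ball. -/
def killingMap (κ : ℂ) (x : Eucl n) : S →L[ℂ] S :=
  √(1 + √(1 + ‖x‖ ^ 2)) • (1 : S →L[ℂ] S)
    - (√(1 + √(1 + ‖x‖ ^ 2)))⁻¹ • ((κ • flatCliff ρ) x)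

theorem killingMap_eq (κ : ℂ) (x : Eucl n) :
    killingMap ρ κ x = (√(1 + √(1 + ‖x‖ ^ 2)) : ℂ) • (1 : S →L[ℂ] S)
      - (κ / (√(1 + √(1 + ‖x‖ ^ 2)) : ℂ)) • flatCliff ρ x := by
  rw [killingMap, ← Complex.coe_smul, ← Complex.coe_smul, smul_apply, smul_smul]
  push_cast
  rw [div_eq_inv_mul]

theorem sq_sqrt_one_add_sqrt (x : Eucl n) :
    (√(1 + √(1 + ‖x‖ ^ 2)) : ℂ) ^ 2 = 1 + (√(1 + ‖x‖ ^ 2) : ℂ) := by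
  exact_mod_cast Real.sq_sqrt (by positivity : 0 ≤ 1 + √(1 + ‖x‖ ^ 2))

theorem sqrt_one_add_sqrt_ne_zero (x : Eucl n) : (√(1 + √(1 + ‖x‖ ^ 2)) : ℂ) ≠ 0 := by
  exact_mod_cast (by positivity : √(1 + √(1 + ‖x‖ ^ 2)) ≠ 0)

theorem flatCliff_mul_self' (x : Eucl n) :
    flatCliff ρ x * flatCliff ρ x = (-((√(1 + ‖x‖ ^ 2) : ℂ) ^ 2 - 1)) • (1 : S →L[ℂ] S) := by
  rw [flatCliff_mul_self]
  congr 2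
  have : √(1 + ‖x‖ ^ 2) ^ 2 = 1 + ‖x‖ ^ 2 := Real.sq_sqrt (by positivity)
  exact_mod_cast (by rw [this]; ring : ‖x‖ ^ 2 = √(1 + ‖x‖ ^ 2) ^ 2 - 1)

/-- With r = √(1 + |x|²), the cross terms cancel and p² + c(x)²/p² = (1 + r) - (r - 1). This gives
the inverse of `killingMap` up to the factor 2. -/
theorem killingMap_mul_killingMap_neg (κ : ℂ) (hκ : κ * κ = -1) (x : Eucl n) :
    killingMap ρ κ x * killingMap ρ (-κ) x = (2 : ℂ) • 1 := by
  rw [killingMap_eq, killingMap_eq]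
  have h1 := sq_sqrt_one_add_sqrt x
  have h2 := sqrt_one_add_sqrt_ne_zero x
  simp only [mul_sub, sub_mul, smul_mul_smul_comm, mul_one, one_mul, flatCliff_mul_self',
    smul_smul]
  generalize (√(1 + √(1 + ‖x‖ ^ 2)) : ℂ) = p at *
  generalize (√(1 + ‖x‖ ^ 2) : ℂ) = r at *
  obtain rfl : r = p ^ 2 - 1 := by rw [h1]; ring
  match_scalars
  · field_simp
    linear_combination (p ^ 4 - 2 * p ^ 2) * hκ
  · ring

theorem contDiff_sqrt_one_add_sqrt :
    ContDiff ℝ ∞ fun x : Eucl n => √(1 + √(1 + ‖x‖ ^ 2)) :=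
  (contDiff_const.add ((contDiff_const.add (contDiff_norm_sq ℝ)).sqrt
    fun x => by positivity)).sqrt fun x => by positivity

theorem contDiff_killingMap (κ : ℂ) : ContDiff ℝ ∞ (killingMap ρ κ) :=
  (contDiff_sqrt_one_add_sqrt.smul contDiff_const).sub
    ((contDiff_sqrt_one_add_sqrt.inv fun x => by positivity).smul (κ • flatCliff ρ).contDiff)

theorem fderiv_killingMap (κ : ℂ) (x v : Eucl n) :
    fderiv ℝ (killingMap ρ κ) x v =
      ((inner ℝ x v : ℝ) / (2 * √(1 + √(1 + ‖x‖ ^ 2)) * √(1 + ‖x‖ ^ 2)) : ℂ) • (1 : S →L[ℂ] S)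
      + (κ * (inner ℝ x v : ℝ) / (2 * √(1 + √(1 + ‖x‖ ^ 2)) ^ 3 * √(1 + ‖x‖ ^ 2)) : ℂ)
        • flatCliff ρ x
      - (κ / (√(1 + √(1 + ‖x‖ ^ 2)) : ℂ)) • flatCliff ρ v := by
  have hp : √(1 + √(1 + ‖x‖ ^ 2)) ≠ 0 := by positivity
  have h1 := ((hasFDerivAt_sqrt_one_add_norm_sq x).const_add 1).sqrt (by positivity)
  have h2 := (hasDerivAt_inv hp).comp_hasFDerivAt x h1
  have h : HasFDerivAt (killingMap ρ κ) _ x :=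
    (h1.smul_const (1 : S →L[ℂ] S)).sub (h2.smul (κ • flatCliff ρ).hasFDerivAt)
  rw [h.fderiv]
  have hp2 := sqrt_one_add_sqrt_ne_zero x
  have hr2 : (√(1 + ‖x‖ ^ 2) : ℂ) ≠ 0 := by
    exact_mod_cast (by positivity : √(1 + ‖x‖ ^ 2) ≠ 0)
  simp [← Complex.coe_smul, smul_smul]
  match_scalars <;> field_simp

/-- The spinors `killingMap ρ κ · u` solve the Killing equation. -/
theorem fderiv_killingMap_add (κ : ℂ) (hκ : κ * κ = -1) (x v : Eucl n) :
    fderiv ℝ (killingMap ρ κ) x v + spinConn (hypFrame n) ρ x v * killingMap ρ κ x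
      + (κ / 2) • cliff (hypFrame n) ρ x v * killingMap ρ κ x = 0 := by
  have hr2 : (√(1 + ‖x‖ ^ 2) : ℂ) ≠ 0 := by
    exact_mod_cast (by positivity : √(1 + ‖x‖ ^ 2) ≠ 0)
  rw [fderiv_killingMap, spinConn_hypFrame, cliff_hypFrame, killingMap_eq]
  push_cast
  exact killing_identity (flatCliff ρ x) (flatCliff ρ v) _ _ _ κ (flatCliff_mul_self' ρ x)
    (flatCliff_mul_add ρ x v) (sq_sqrt_one_add_sqrt x) (sqrt_one_add_sqrt_ne_zero x) hr2 hκ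

/-- The Leibniz rule, with the restriction of scalars from ℂ to ℝ hidden in the existential. -/
theorem hasFDerivWithinAt_killingMap_apply (κ : ℂ) {D : Set (Eucl n)} {f : Eucl n → S}
    {f' : Eucl n →L[ℝ] S} {x : Eucl n} (hf : HasFDerivWithinAt f f' D x) :
    ∃ L : Eucl n →L[ℝ] S, HasFDerivWithinAt (fun z => killingMap ρ κ z (f z)) L D x ∧
      ∀ v, L v = fderiv ℝ (killingMap ρ κ) x v (f x) + killingMap ρ κ x (f' v) := by
  have h1 := (((contDiff_killingMap ρ κ).differentiable (by simp)) x).hasFDerivAt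
  have h2 := ((ContinuousLinearMap.restrictScalarsL ℂ S S ℝ ℝ).hasFDerivAt.comp x
    h1).hasFDerivWithinAt (s := D)
  refine ⟨_, h2.clm_apply hf, fun v => ?_⟩
  simp
  abel

theorem contDiffOn_killingMap_apply (κ : ℂ) {D : Set (Eucl n)} {f : Eucl n → S}
    (hf : ContDiffOn ℝ ∞ f D) : ContDiffOn ℝ ∞ (fun z => killingMap ρ κ z (f z)) D := by
  have h2 := ((ContinuousLinearMap.restrictScalarsL ℂ S S ℝ ℝ).contDiff.comp
    (contDiff_killingMap ρ κ)).contDiffOn (s := D)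
  simpa using h2.clm_apply hf

variable [NeZero n] {s : ℝ}

theorem exists_coord_eq {x : Eucl n} (hx : x ∈ halfSpace n s) : ∃ p : HypRegion n s, p.1.2 = x :=
  ⟨⟨hypParam x, (hypParam_bijOn n s).mapsTo hx⟩, rfl⟩

theorem convex_halfSpace : Convex ℝ (halfSpace n s) :=
  convex_halfSpace_le (f := fun x : Eucl n => x 0) ⟨fun _ _ => rfl, fun _ _ => rfl⟩ s

/-- Variation of constants: relative to the invertible solution `killingMap`, the Killing equation
says that the coefficient is constant on the convex half-space. -/
theorem mem_killingSpinors_iff (ε : ℤˣ) (Φ : HypRegion n s → S) :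
    Φ ∈ killingSpinors ρ s ε ↔
      ∃ u, ∀ p : HypRegion n s, Φ p = killingMap ρ (((ε : ℤ) : ℂ) * Complex.I) p.1.2 u := by
  set κ := ((ε : ℤ) : ℂ) * Complex.I with hκdef
  have hε := intUnits_coe_mul_self ε
  have hκ : κ * κ = -1 := by
    rw [hκdef, mul_mul_mul_comm, hε, Complex.I_mul_I, one_mul]
  have hinv : ∀ x v, killingMap ρ κ x (killingMap ρ (-κ) x v) = (2 : ℂ) • v := fun x v =>
    DFunLike.congr_fun (killingMap_mul_killingMap_neg ρ κ hκ x) v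
  have hinv' : ∀ x v, killingMap ρ (-κ) x (killingMap ρ κ x v) = (2 : ℂ) • v := fun x v => by
    have := killingMap_mul_killingMap_neg ρ (-κ) (by rw [neg_mul_neg, hκ]) x
    rw [neg_neg] at this
    exact DFunLike.congr_fun this v
  have hκ2 : ((ε : ℤ) : ℂ) * (Complex.I / 2) = κ / 2 := by rw [hκdef]; ring
  have hker : ∀ x v w, fderiv ℝ (killingMap ρ κ) x v w
      + spinConn (hypFrame n) ρ x v (killingMap ρ κ x w)
      + (κ / 2) • cliff (hypFrame n) ρ x v (killingMap ρ κ x w) = 0 := fun x v w =>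
    DFunLike.congr_fun (fderiv_killingMap_add ρ κ hκ x v) w
  have huniq := halfSpace_uniqueDiffOn n s
  constructor
  · rintro ⟨hs, hK⟩
    have hsm := contDiffOn_killingMap_apply ρ (-κ) hs
    have hd := hsm.differentiableOn (by simp)
    have hψ : coordRep Φ = fun z => killingMap ρ κ z
        ((fun z => (1 / 2 : ℂ) • killingMap ρ (-κ) z (coordRep Φ z)) z) := by
      funext z
      simp only [map_smul, hinv, smul_smul]
      norm_num
    have hconst : ∀ x ∈ halfSpace n s,
        fderivWithin ℝ (fun z => (1 / 2 : ℂ) • killingMap ρ (-κ) z (coordRep Φ z))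
          (halfSpace n s) x = 0 := by
      intro x hx
      have hφ : DifferentiableWithinAt ℝ
          (fun z => (1 / 2 : ℂ) • killingMap ρ (-κ) z (coordRep Φ z)) (halfSpace n s) x :=
        (hd x hx).const_smul (1 / 2 : ℂ)
      obtain ⟨L, hL, hLv⟩ := hasFDerivWithinAt_killingMap_apply ρ κ hφ.hasFDerivWithinAt
      ext v
      have h1 := hK x hx v
      rw [hκ2, spinDeriv] at h1
      rw [hψ, hL.fderivWithin (huniq x hx), hLv] at h1
      have h2 := hker x v ((1 / 2 : ℂ) • killingMap ρ (-κ) x (coordRep Φ x))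
      have h3 : killingMap ρ κ x (fderivWithin ℝ
          (fun z => (1 / 2 : ℂ) • killingMap ρ (-κ) z (coordRep Φ z)) (halfSpace n s) x v) = 0 := by
        -- Subtracting the equation of the columns from that of Φ leaves only the Leibniz term with
        -- the derivative of the coefficient.
        rw [← sub_eq_zero.2 (h1.trans h2.symm)]
        dsimp only [Pi.smul_apply]
        abel
      have h4 := hinv' x (fderivWithin ℝ
          (fun z => (1 / 2 : ℂ) • killingMap ρ (-κ) z (coordRep Φ z)) (halfSpace n s) x v)
      rw [h3, map_zero, eq_comm, smul_eq_zero] at h4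
      simpa using h4
    -- A base point lying in the half-space for either sign of s, unlike the origin.
    have h0 : EuclideanSpace.single 0 s ∈ halfSpace n s := by simp [halfSpace]
    refine ⟨(1 / 2 : ℂ) • killingMap ρ (-κ) (EuclideanSpace.single 0 s)
      (coordRep Φ (EuclideanSpace.single 0 s)), fun p => ?_⟩
    have hp : p.1.2 ∈ halfSpace n s := p.2.2.2
    have := convex_halfSpace.is_const_of_fderivWithin_eq_zero (𝕜 := ℝ)
      (hd.const_smul (1 / 2 : ℂ)) hconst hp h0
    rw [← coordRep_apply Φ p]
    conv_lhs => rw [hψ]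
    exact congrArg (killingMap ρ κ p.1.2) this
  · rintro ⟨u, hu⟩
    have heq : Set.EqOn (coordRep Φ) (fun z => killingMap ρ κ z u) (halfSpace n s) := by
      intro x hx
      obtain ⟨p, rfl⟩ := exists_coord_eq hx
      rw [coordRep_apply, hu]
    refine ⟨(contDiffOn_killingMap_apply ρ κ contDiffOn_const).congr heq, fun x hx v => ?_⟩
    obtain ⟨L, hL, hLv⟩ := hasFDerivWithinAt_killingMap_apply ρ κ
      (hasFDerivWithinAt_const u x (halfSpace n s))
    rw [spinDeriv, fderivWithin_congr heq (heq hx), hL.fderivWithin (huniq x hx), heq hx, hLv, hκ2,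
      zero_apply, map_zero, add_zero]
    exact hker x v u

end

/-! ### The boundary condition -/

/-- The Clifford algebra identity behind the boundary condition. -/
theorem boundary_identity {A : Type*} [Ring A] [Algebra ℂ A] (a e Q : A) (r s p ε : ℂ)
    (ha : a * a = (-(r ^ 2 - 1)) • (1 : A)) (hae : a * e + e * a = (-2 * s) • (1 : A))
    (hQ : Q * Q = 1) (hQa : Q * a = -(a * Q)) (hQe : Q * e = -(e * Q))
    (hp : p ^ 2 = 1 + r) (hp0 : p ≠ 0) (hε : ε * ε = 1) :
    (Q + (Complex.I * s) • (1 : A)) * (e + (s / (1 + r)) • a)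
        * (p • (1 : A) - (ε * Complex.I / p) • a) =
      ε • ((Q + (Complex.I * s) • (1 : A)) * (p • (1 : A) - (-(ε * Complex.I) / p) • a)
        * (Q + ε • e)) - (ε * (1 + s ^ 2)) • (p • (1 : A) - (ε * Complex.I / p) • a) := by
  -- Normal ordering again: a goes left of e, and both go left of Q.
  have hea : e * a = (-2 * s) • (1 : A) - a * e := eq_sub_of_add_eq' hae
  have hea' : ∀ y, e * (a * y) = (-2 * s) • y - a * (e * y) := fun y => by
    rw [← mul_assoc, hea, sub_mul, smul_one_mul, mul_assoc]
  have ha' : ∀ y, a * (a * y) = (-(r ^ 2 - 1)) • y := fun y => by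
    rw [← mul_assoc, ha, smul_one_mul]
  obtain rfl : r = p ^ 2 - 1 := by rw [hp]; ring
  have hε3 : ε ^ 3 = ε := by rw [pow_succ, sq, hε, one_mul]
  simp only [mul_add, mul_sub, add_mul, sub_mul, smul_add, smul_sub,
    mul_smul_comm, smul_mul_assoc, mul_one, one_mul, mul_assoc, neg_mul, hea', ha', hQ,
    hQa, hQe, hea, ha, smul_neg, mul_neg, smul_smul]
  rw [show 1 + (p ^ 2 - 1) = p ^ 2 by ring]
  match_scalars
  all_goals field_simp
  all_goals (try simp only [Complex.I_sq, hε3, show ε ^ 2 = 1 by rw [sq, hε]])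
  all_goals try ring

section

variable {n : ℕ} [NeZero n] {S : Type*} [NormedAddCommGroup S] [NormedSpace ℂ S]
  (ρ : CliffordAlgebra (negForm n) →ₐ[ℝ] (S →L[ℂ] S))

/-- The gradient is the tangential projection ∂₁ + x₁ X of the ambient ∂₁ at the point X, because
⟨X, X⟩ = -1. -/
theorem gradX1_eq (x : Eucl n) : gradX1 n x = EuclideanSpace.single 0 1 + x 0 • x := by
  have hp : (0 : ℝ) < 1 + ‖x‖ ^ 2 := by positivity
  have hr : √(1 + ‖x‖ ^ 2) ^ 2 = 1 + ‖x‖ ^ 2 := Real.sq_sqrt hp.le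
  have hm : (1 : ℝ) + √(1 + ‖x‖ ^ 2) ≠ 0 := by positivity
  have hf : ∀ v, fderiv ℝ (fun z : Eucl n => z 0) x v = v 0 := fun v => by
    rw [show (fun z : Eucl n => z 0) = (EuclideanSpace.proj 0 : Eucl n →L[ℝ] ℝ) from rfl,
      ContinuousLinearMap.fderiv]
    rfl
  ext j
  simp only [gradX1, OrthoFrame.grad, hf]
  have hsum : ∑ i, x i ^ 2 = ‖x‖ ^ 2 := (EuclideanSpace.real_norm_sq_eq x).symm
  have hterm : ∀ i, ((hypFrame n).vec i x) 0 * ((hypFrame n).vec i x) j =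
      (if i = 0 then (if i = j then 1 else 0) else 0)
        + (if i = j then x i * x 0 / (1 + √(1 + ‖x‖ ^ 2)) else 0)
        + (if i = 0 then x i * x j / (1 + √(1 + ‖x‖ ^ 2)) else 0)
        + x i ^ 2 * (x 0 * x j / (1 + √(1 + ‖x‖ ^ 2)) ^ 2) := by
    intro i
    simp only [hypFrame, PiLp.add_apply, PiLp.smul_apply, smul_eq_mul, PiLp.single_apply,
      eq_comm (a := (0 : Fin n)), eq_comm (a := j)]
    split_ifs <;> field_simp <;> ring
  rw [WithLp.ofLp_sum, Finset.sum_apply]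
  simp only [PiLp.smul_apply, smul_eq_mul, hterm, Finset.sum_add_distrib, ← Finset.sum_mul, hsum,
    Finset.sum_ite_eq', Finset.mem_univ, if_true, PiLp.add_apply, PiLp.single_apply,
    eq_comm (a := (0 : Fin n))]
  rw [show ‖x‖ ^ 2 = √(1 + ‖x‖ ^ 2) ^ 2 - 1 by rw [hr]; ring]
  rw [show 1 + (√(1 + ‖x‖ ^ 2) ^ 2 - 1) = √(1 + ‖x‖ ^ 2) ^ 2 by ring,
    Real.sqrt_sq (Real.sqrt_nonneg _)]
  field_simp
  ring

theorem cliff_inwardNormal (x : Eucl n) :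
    cliff (hypFrame n) ρ x (inwardNormal n x) = (-(1 / √(1 + x 0 ^ 2) : ℝ) : ℂ) •
      (flatCliff ρ (EuclideanSpace.single 0 1)
        + ((x 0 : ℂ) / (1 + √(1 + ‖x‖ ^ 2))) • flatCliff ρ x) := by
  have hp : (0 : ℝ) < 1 + ‖x‖ ^ 2 := by positivity
  have hr : √(1 + ‖x‖ ^ 2) ^ 2 = 1 + ‖x‖ ^ 2 := Real.sq_sqrt hp.le
  have hr0 : √(1 + ‖x‖ ^ 2) ≠ 0 := by positivity
  have hm : (1 : ℝ) + √(1 + ‖x‖ ^ 2) ≠ 0 := by positivity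
  have hg : hypMetric x (gradX1 n x) (gradX1 n x) = 1 + x 0 ^ 2 := by
    rw [gradX1_eq, hypMetric_apply]
    simp only [inner_add_left, inner_add_right, inner_smul_left, inner_smul_right,
      real_inner_self_eq_norm_sq, EuclideanSpace.inner_single_left,
      EuclideanSpace.inner_single_right]
    simp
    field_simp
    ring
  have hx : inner ℝ x (gradX1 n x) = x 0 * (1 + ‖x‖ ^ 2) := by
    rw [gradX1_eq]
    simp only [inner_add_right, inner_smul_right, real_inner_self_eq_norm_sq,
      EuclideanSpace.inner_single_right]
    simp
    ring
  rw [cliff_hypFrame, inwardNormal, hg, inner_neg_right, inner_smul_right, hx, ← hr, gradX1_eq]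
  simp only [map_neg, map_smul, map_add, ← Complex.coe_smul]
  rw [hr]
  match_scalars
  · simp
  · have hr0' : (√(1 + ‖x‖ ^ 2) : ℂ) ≠ 0 := by exact_mod_cast hr0
    have hm' : (1 + √(1 + ‖x‖ ^ 2) : ℂ) ≠ 0 := by exact_mod_cast hm
    have hrc : (√(1 + ‖x‖ ^ 2) : ℂ) ^ 2 = 1 + (‖x‖ : ℂ) ^ 2 := by exact_mod_cast hr
    rw [← hrc]
    field_simp
    ring

/-- Euler's formula gives e^{iθQ} Q = cos θ (Q + is), and the normalization of ν contributes the
other factor -cos θ. -/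
theorem thetaOp_eq (hn : Even n) {s θ : ℝ} (hsin : Real.sin θ = s * Real.cos θ)
    (hcos : Real.cos θ = 1 / √(1 + s ^ 2)) {x : Eucl n} (hx : x 0 = s) :
    thetaOp ρ θ x = (-(Real.cos θ : ℂ) ^ 2) •
      ((flatVolume ρ + (Complex.I * s) • (1 : S →L[ℂ] S)) *
        (flatCliff ρ (EuclideanSpace.single 0 1)
          + ((s : ℂ) / (1 + √(1 + ‖x‖ ^ 2))) • flatCliff ρ x)) := by
  have h : NormedSpace.exp ((Complex.I * θ) • flatVolume ρ) * flatVolume ρ =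
      (Real.cos θ : ℂ) • (flatVolume ρ + (Complex.I * s) • (1 : S →L[ℂ] S)) := by
    rw [exp_smul_of_mul_self_eq_one (flatVolume_mul_self ρ hn), hsin, add_mul, smul_mul_assoc,
      smul_mul_assoc, one_mul, flatVolume_mul_self ρ hn]
    push_cast
    module
  rw [thetaOp, chirality_hypFrame, h, cliff_inwardNormal, hx, ← hcos, smul_mul_smul_comm]
  congr 1
  ring

/-- Along `Σ_s` the boundary condition for the Killing spinor generated by `u` is a condition
on `u` alone. -/
theorem thetaOp_killingMap_iff (hn : Even n) {s θ : ℝ} (hsin : Real.sin θ = s * Real.cos θ)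
    (hcos : Real.cos θ = 1 / √(1 + s ^ 2)) (ε : ℂ) (hε : ε * ε = 1) {x : Eucl n} (hx : x 0 = s)
    (u : S) :
    thetaOp ρ θ x (killingMap ρ (ε * Complex.I) x u) =
        ε • killingMap ρ (ε * Complex.I) x u ↔
      (flatVolume ρ * flatCliff ρ (EuclideanSpace.single 0 1)) u = (-ε) • u := by
  have hκ : (ε * Complex.I) * (ε * Complex.I) = -1 := by
    rw [mul_mul_mul_comm, hε, Complex.I_mul_I, one_mul]
  have hQ := flatVolume_mul_self ρ hn
  have hQe := flatVolume_mul_flatCliff ρ hn (EuclideanSpace.single 0 1)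
  have hae := flatCliff_mul_add ρ x (EuclideanSpace.single 0 1)
  have hinner : inner ℝ x (EuclideanSpace.single 0 (1 : ℝ)) = s := by
    rw [EuclideanSpace.inner_single_right]
    simp [hx]
  rw [hinner] at hae
  have hid := boundary_identity (flatCliff ρ x) (flatCliff ρ (EuclideanSpace.single 0 1))
    (flatVolume ρ) _ _ _ ε (flatCliff_mul_self' ρ x) hae hQ
    (flatVolume_mul_flatCliff ρ hn x) hQe (sq_sqrt_one_add_sqrt x) (sqrt_one_add_sqrt_ne_zero x) hε
  rw [← killingMap_eq, ← killingMap_eq] at hid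
  set e := flatCliff ρ (EuclideanSpace.single 0 1)
  set Q := flatVolume ρ
  set M := killingMap ρ (ε * Complex.I) x
  set N := killingMap ρ (-(ε * Complex.I)) x with hN
  have hMN : M * N = (2 : ℂ) • 1 := killingMap_mul_killingMap_neg ρ _ hκ x
  have hs : (1 + (s : ℂ) ^ 2) ≠ 0 := by
    exact_mod_cast (by positivity : (1 : ℝ) + s ^ 2 ≠ 0)
  have hc2 : (Real.cos θ : ℂ) ^ 2 * (1 + (s : ℂ) ^ 2) = 1 := by
    have : Real.cos θ ^ 2 * (1 + s ^ 2) = 1 := by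
      rw [hcos, div_pow, Real.sq_sqrt (by positivity)]
      field_simp
    exact_mod_cast this
  have hc0 : (Real.cos θ : ℂ) ^ 2 ≠ 0 := left_ne_zero_of_mul_eq_one hc2
  have hε0 : ε ≠ 0 := left_ne_zero_of_mul_eq_one hε
  -- Since s is real, 1 + s² is nonzero, so Q + is is injective and can be cancelled.
  have hinv : (Q - (Complex.I * s) • (1 : S →L[ℂ] S)) * (Q + (Complex.I * s) • 1) =
      (1 + (s : ℂ) ^ 2) • 1 := by
    simp only [mul_add, sub_mul, hQ, mul_one, smul_mul_assoc, mul_smul_comm,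
      one_mul]
    match_scalars
    · linear_combination (-(s : ℂ) ^ 2) * Complex.I_mul_I
    · ring
  have key : thetaOp ρ θ x * M = ε • M - ((Real.cos θ : ℂ) ^ 2 * ε) •
      ((Q + (Complex.I * s) • 1) * N * (Q + ε • e)) := by
    rw [thetaOp_eq ρ hn hsin hcos hx, smul_mul_assoc, hid, smul_sub, smul_smul, smul_smul]
    have : -(Real.cos θ : ℂ) ^ 2 * (ε * (1 + (s : ℂ) ^ 2)) = -ε := by
      linear_combination (-ε) * hc2
    rw [this]
    module
  have hw : (Q + ε • e) u = 0 ↔ (Q * e) u = (-ε) • u := by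
    have h1 : Q * (Q + ε • e) = ε • (Q * e - (-ε) • 1) := by
      rw [mul_add, hQ, mul_smul_comm, smul_sub, smul_smul, mul_neg, hε]
      module
    have h2 : Q * (Q * e - (-ε) • 1) = ε • (Q + ε • e) := by
      rw [mul_sub, ← mul_assoc, hQ, one_mul, mul_smul_comm, mul_one, smul_add, smul_smul, hε]
      module
    have h1u : Q ((Q + ε • e) u) = ε • ((Q * e) u - (-ε) • u) := DFunLike.congr_fun h1 u
    have h2u : Q ((Q * e) u - (-ε) • u) = ε • ((Q + ε • e) u) := DFunLike.congr_fun h2 u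
    constructor
    · intro h
      rw [h, map_zero, eq_comm, smul_eq_zero] at h1u
      exact sub_eq_zero.1 (h1u.resolve_left hε0)
    · intro h
      rw [h, sub_self, map_zero, eq_comm, smul_eq_zero] at h2u
      exact h2u.resolve_left hε0
  have keyu : thetaOp ρ θ x (M u) = ε • M u - ((Real.cos θ : ℂ) ^ 2 * ε) •
      (Q + (Complex.I * s) • (1 : S →L[ℂ] S)) (N ((Q + ε • e) u)) := DFunLike.congr_fun key u
  rw [← hw, keyu, sub_eq_self, smul_eq_zero, or_iff_right (mul_ne_zero hc0 hε0)]
  constructor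
  · intro h
    have h1 : (Q - (Complex.I * s) • (1 : S →L[ℂ] S))
        ((Q + (Complex.I * s) • (1 : S →L[ℂ] S)) (N ((Q + ε • e) u))) =
        (1 + (s : ℂ) ^ 2) • N ((Q + ε • e) u) := DFunLike.congr_fun hinv _
    rw [h, map_zero, eq_comm, smul_eq_zero] at h1
    have h2 : M (N ((Q + ε • e) u)) = (2 : ℂ) • ((Q + ε • e) u) := DFunLike.congr_fun hMN _
    rw [h1.resolve_left hs, map_zero, eq_comm, smul_eq_zero] at h2
    exact h2.resolve_left two_ne_zero
  · intro h
    rw [h, map_zero, map_zero]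

/-! ### Parametrization by constant spinors and the dimension count -/

/-- The Killing spinor generated by a constant spinor. -/
def killingField (s : ℝ) (κ : ℂ) : S →ₗ[ℂ] (HypRegion n s → S) where
  toFun u p := killingMap ρ κ p.1.2 u
  map_add' u v := by funext p; simp
  map_smul' c u := by funext p; simp

theorem killingField_injective (s : ℝ) (κ : ℂ) (hκ : κ * κ = -1) :
    Function.Injective (killingField ρ s κ) := by
  rw [← LinearMap.ker_eq_bot, LinearMap.ker_eq_bot']
  intro u hu
  obtain ⟨p, hp⟩ := exists_coord_eq (n := n) (s := s) (x := EuclideanSpace.single 0 s)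
    (by simp [halfSpace])
  have h := killingMap_mul_killingMap_neg ρ (-κ) (by rw [neg_mul_neg, hκ]) p.1.2
  rw [neg_neg] at h
  have h1 : killingMap ρ (-κ) p.1.2 (killingMap ρ κ p.1.2 u) = (2 : ℂ) • u :=
    DFunLike.congr_fun h u
  rw [show killingMap ρ κ p.1.2 u = 0 from congrFun hu p, map_zero, eq_comm, smul_eq_zero] at h1
  exact h1.resolve_left two_ne_zero

theorem thetaKillingSpinors_eq_map (hn : Even n) {s θ : ℝ}
    (hsin : Real.sin θ = s * Real.cos θ) (hcos : Real.cos θ = 1 / √(1 + s ^ 2)) (ε : ℤˣ) :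
    thetaKillingSpinors ρ s θ ε =
      (LinearMap.ker ((flatVolume ρ * flatCliff ρ (EuclideanSpace.single 0 1) : S →L[ℂ] S).toLinearMap
        - (-((ε : ℤ) : ℂ)) • (1 : Module.End ℂ S))).map
        (killingField ρ s (((ε : ℤ) : ℂ) * Complex.I)) := by
  have hε := intUnits_coe_mul_self ε
  have hiff := fun (x : Eucl n) (hx : x 0 = s) (u : S) =>
    thetaOp_killingMap_iff ρ hn hsin hcos _ hε hx u
  ext Φ
  rw [Submodule.mem_map]
  constructor
  · rintro ⟨hK, hb⟩
    obtain ⟨u, hu⟩ := (mem_killingSpinors_iff ρ ε Φ).1 hK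
    refine ⟨u, ?_, (funext hu).symm⟩
    -- One boundary point determines the condition on u; conversely that condition serves every
    -- boundary point.
    obtain ⟨p, hp⟩ := exists_coord_eq (n := n) (s := s) (x := EuclideanSpace.single 0 s)
      (by simp [halfSpace])
    have hp0 : p.1.2 0 = s := by rw [hp]; simp
    have h := hb p hp0
    rw [hu p, hiff _ hp0] at h
    rw [LinearMap.mem_ker]
    exact sub_eq_zero.2 h
  · rintro ⟨u, hu, rfl⟩
    refine ⟨(mem_killingSpinors_iff ρ ε _).2 ⟨u, fun p => rfl⟩, fun p hp => ?_⟩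
    rw [LinearMap.mem_ker] at hu
    exact (hiff _ hp u).2 (sub_eq_zero.1 hu)

theorem two_mul_finrank_thetaKillingSpinors [FiniteDimensional ℂ S] (hn : Even n) {s θ : ℝ}
    (hsin : Real.sin θ = s * Real.cos θ) (hcos : Real.cos θ = 1 / √(1 + s ^ 2)) (ε : ℤˣ) :
    2 * Module.finrank ℂ (thetaKillingSpinors ρ s θ ε) = Module.finrank ℂ S := by
  have hε := intUnits_coe_mul_self ε
  have hκ : (((ε : ℤ) : ℂ) * Complex.I) * (((ε : ℤ) : ℂ) * Complex.I) = -1 := by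
    rw [mul_mul_mul_comm, hε, Complex.I_mul_I, one_mul]
  have hQ := flatVolume_mul_self ρ hn
  have he := flatCliff_single_mul_self ρ 0
  have hQe := flatVolume_mul_flatCliff ρ hn (EuclideanSpace.single 0 1)
  rw [thetaKillingSpinors_eq_map ρ hn hsin hcos, ← (Submodule.equivMapOfInjective _
    (killingField_injective ρ s _ hκ) _).finrank_eq]
  set e := flatCliff ρ (EuclideanSpace.single 0 1)
  set Q := flatVolume ρ
  have h1 : (Q * e) * (Q * e) = 1 := by
    rw [mul_assoc, ← mul_assoc e, ← neg_eq_iff_eq_neg.2 hQe, neg_mul, mul_neg, mul_assoc Q, he,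
      mul_neg_one, mul_neg, neg_neg, hQ]
  have h2 : (Q * e) * Q = -(Q * (Q * e)) := by
    rw [mul_assoc, ← neg_eq_iff_eq_neg.2 hQe, mul_neg]
  exact two_mul_finrank_ker_of_anticomm _ Q.toLinearMap
    (LinearMap.ext fun v => DFunLike.congr_fun h1 v)
    (LinearMap.ext fun v => DFunLike.congr_fun hQ v)
    (LinearMap.ext fun v => DFunLike.congr_fun h2 v) _ (by rw [neg_mul_neg, hε])

end

end

end HypSpin

theorem proposition3p8 (n k : ℕ) [NeZero n] (hn : n = 2 * k)
    {S : Type*} [NormedAddCommGroup S] [NormedSpace ℂ S]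
    (ρ : CliffordAlgebra (HypSpin.negForm n) →ₐ[ℝ] (S →L[ℂ] S))
    (hS : Module.finrank ℂ S = 2 ^ k)
    (s θ : ℝ) (hθ : θ ∈ Set.Ioo (-(Real.pi / 2)) (Real.pi / 2))
    (hsθ : Real.sin θ = s / √(1 + s ^ 2)) (ε : ℤˣ) :
    Module.finrank ℂ (HypSpin.thetaKillingSpinors ρ s θ ε) = 2 ^ (k - 1) ∧
      HypSpin.thetaKillingSpinors ρ s θ ε ≠ ⊥ := by
  -- `finrank` is 0 in infinite dimension, so a positive value forces finiteness.
  have hfin : FiniteDimensional ℂ S := Module.finite_of_finrank_pos (by rw [hS]; positivity)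
  have hcos : Real.cos θ = 1 / √(1 + s ^ 2) := by
    have h1 : 0 < Real.cos θ := Real.cos_pos_of_mem_Ioo hθ
    have h2 := Real.sin_sq_add_cos_sq θ
    rw [hsθ, div_pow, Real.sq_sqrt (by positivity)] at h2
    have h3 : Real.cos θ ^ 2 = 1 / (1 + s ^ 2) := by
      have h4 : (1 : ℝ) + s ^ 2 ≠ 0 := by positivity
      rw [eq_sub_of_add_eq' h2]
      field_simp
      ring
    rw [← Real.sqrt_sq h1.le, h3, Real.sqrt_div zero_le_one, Real.sqrt_one]
  have hsin : Real.sin θ = s * Real.cos θ := by rw [hsθ, hcos, mul_one_div]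
  have h := HypSpin.two_mul_finrank_thetaKillingSpinors ρ (hn ▸ even_two_mul k) hsin hcos ε
  -- Since n ≠ 0, k ≥ 1 and the subtraction in k - 1 is not truncated.
  obtain ⟨l, rfl⟩ : ∃ l, k = l + 1 :=
    Nat.exists_eq_succ_of_ne_zero fun h0 => NeZero.ne n (by rw [hn, h0, mul_zero])
  have hrank : Module.finrank ℂ (HypSpin.thetaKillingSpinors ρ s θ ε) = 2 ^ (l + 1 - 1) := by
    rw [hS, pow_succ] at h
    rw [Nat.add_sub_cancel]
    omega
  refine ⟨hrank, fun hbot => ?_⟩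
  rw [hbot, finrank_bot] at hrank
  exact (pow_ne_zero _ two_ne_zero) hrank.symm
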